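/- Let $a,b\in\mathbb{R}\setminus\{0\}$ and let $\nu_1,\nu_2:\mathbb{R}^2\to\mathbb{R}$ be smooth ($C^\infty$) functions with $\nu_1(0,0)=\nu_2(0,0)=0$. For every $(j,t)\in\mathbb{R}^2$, consider $$H_{j,t}(q,p)=\frac{a}{2}p^{2}+\frac{b}{6}q^{6}+\frac{\nu_1(j,t)}{2}q^{2}+\frac{\nu_2(j,t)}{4}q^{4}.$$ Then the germ of $H_{j,t}$ at the origin $(q,p)=(0,0)$ is $6$-determined: every germ at the origin of a smooth function $f:\mathbb{R}^2\to\mathbb{R}$ with the same $6$-jet as $H_{j,t}$ (that is, the same Taylor polynomial of degree $6$ at the origin) is equivalent to the germ of $H_{j,t}$, meaning that there is a germ $g:(\mathbb{R}^2,0)\to(\mathbb{R}^2,0)$ of a smooth diffeomorphism fixing the origin such that $f\circ g=H_{j,t}$ as germs at the origin. -/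

import Mathlib

open Filter Topology
open scoped ContDiff

namespace SmoothGerm

variable {E F G : Type*} [NormedAddCommGroup E] [NormedSpace ℝ E]
  [NormedAddCommGroup F] [NormedSpace ℝ F] [NormedAddCommGroup G] [NormedSpace ℝ G]

/-- The germ at the origin of a map `f : E → F`. -/
def germAtZero (f : E → F) : Germ (𝓝 (0 : E)) F := Germ.ofFun f

/-- A germ at the origin is smooth if one of its representatives is `C^∞` on a neighbourhood of
the origin. -/
def IsSmooth (φ : Germ (𝓝 (0 : E)) F) : Prop :=
  ∃ f : E → F, (∀ᶠ x in 𝓝 (0 : E), ContDiffAt ℝ ∞ f x) ∧ germAtZero f = φ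

/-- The degree `k` Taylor polynomial `x ↦ ∑_{i ≤ k} (1 / i!) Dⁱf(0)(x, …, x)` of `f` at the
origin. -/
noncomputable def taylorPolynomial (k : ℕ) (f : E → F) : E → F :=
  fun x => ∑ i ∈ Finset.range (k + 1), ((Nat.factorial i : ℝ)⁻¹) • iteratedFDeriv ℝ i f 0 (fun _ => x)

/-- The Taylor polynomial at the origin depends only on the germ. -/
theorem taylorPolynomial_congr (k : ℕ) {f g : E → F} (h : f =ᶠ[𝓝 (0 : E)] g) :
    taylorPolynomial k f = taylorPolynomial k g := by
  funext x
  unfold taylorPolynomial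
  refine Finset.sum_congr rfl fun i _ => ?_
  rw [(h.iteratedFDeriv ℝ i).eq_of_nhds]

/-- The `k`-jet of a germ at the origin: its Taylor expansion truncated at order `k`. -/
noncomputable def jet (k : ℕ) (φ : Germ (𝓝 (0 : E)) F) : E → F :=
  φ.liftOn (taylorPolynomial k) fun _ _ h => taylorPolynomial_congr k h

/-- Two germs of functions `φ₁` on `E` and `φ₂` on `F` at the origin are (right-)equivalent if
there is an invertible smooth germ `g : (F, 0) → (E, 0)`, with smooth inverse germ
`h : (E, 0) → (F, 0)`, such that `φ₁ ∘ g = φ₂`. -/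
def Equivalent (φ₁ : Germ (𝓝 (0 : E)) G) (φ₂ : Germ (𝓝 (0 : F)) G) : Prop :=
  ∃ (g : Germ (𝓝 (0 : F)) E) (h : Germ (𝓝 (0 : E)) F)
    (hg : g.Tendsto (𝓝 0)) (hh : h.Tendsto (𝓝 0)),
    IsSmooth g ∧ IsSmooth h ∧
    g.compTendsto' h hh = germAtZero id ∧ h.compTendsto' g hg = germAtZero id ∧
    φ₁.compTendsto' g hg = φ₂

/-- A smooth germ `φ` of real functions at the origin is `k`-determined if every smooth germ with
the same `k`-jet is equivalent to it. -/
def IsDetermined (k : ℕ) (φ : Germ (𝓝 (0 : E)) ℝ) : Prop :=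
  IsSmooth φ ∧ ∀ ψ : Germ (𝓝 (0 : E)) ℝ, IsSmooth ψ → jet k ψ = jet k φ → Equivalent ψ φ

end SmoothGerm

/-- The Hamiltonian `H_{j,t}(q, p)` at the point `x = (q, p)` of the plane. -/
noncomputable def hamiltonian (a b : ℝ) (ν₁ ν₂ : ℝ × ℝ → ℝ) (j t : ℝ) (x : ℝ × ℝ) : ℝ :=
  a / 2 * x.2 ^ 2 + b / 6 * x.1 ^ 6 + ν₁ (j, t) / 2 * x.1 ^ 2 + ν₂ (j, t) / 4 * x.1 ^ 4

/-! The function is reduced to one variable by splitting off the nondegenerate direction `p`. Let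
`f` have the same 6-jet as `H`. Since `a ≠ 0`, the equation `∂f/∂p = 0` defines a smooth curve `p =
s(q)` near the origin, and `f = f(q, s(q)) + (p - s(q))² G` with `G(0) = a / 2`.

The jet hypothesis forces `∂f/∂p (q, 0) = o(q³)`, hence `s = o(q³)`; replacing `f(q, 0)` by `f(q,
s(q))` then costs only `O(s²) = o(q⁶)`. So the reduced function has the same leading term `c qⁿ` as
`H(q, 0)`, where `n ∈ {2, 4, 6}`, and `n ≤ 6` because `b ≠ 0`. Absorbing unit factors by taking
roots gives `a / 2 * p² + c qⁿ` in coordinates tangent to the identity (`exists_normal_form`). This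
applies to `f` and to `H` with the same `c` and `n`, and `SmoothGerm.equivalent_of_comp_eq` composes
one coordinate change with the inverse of the other. -/

open Asymptotics

/-! ### Smooth representatives, parametric integrals and Hadamard's lemma -/

/-- A map that is smooth near the origin agrees near the origin with a smooth map. -/
theorem exists_contDiff_eventuallyEq {E F : Type*} [NormedAddCommGroup E] [NormedSpace ℝ E]
    [FiniteDimensional ℝ E] [NormedAddCommGroup F] [NormedSpace ℝ F] {f : E → F}
    (hf : ∀ᶠ x in 𝓝 (0 : E), ContDiffAt ℝ ∞ f x) :
    ∃ g : E → F, ContDiff ℝ ∞ g ∧ g =ᶠ[𝓝 0] f := by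
  obtain ⟨r, hr, h⟩ := Metric.eventually_nhds_iff_ball.1 hf
  let χ : ContDiffBump (0 : E) := ⟨r / 4, r / 2, by positivity, by linarith⟩
  refine ⟨fun x => χ x • f x, contDiff_iff_contDiffAt.2 fun x => ?_, ?_⟩
  · by_cases hx : x ∈ tsupport χ
    · rw [χ.tsupport_eq] at hx
      exact χ.contDiffAt.smul (h x (Metric.closedBall_subset_ball (by simp [χ]; linarith) hx))
    · refine (contDiffAt_const (c := 0)).congr_of_eventuallyEq ?_
      filter_upwards [notMem_tsupport_iff_eventuallyEq.1 hx] with y hy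
      simp [hy]
  · filter_upwards [χ.eventuallyEq_one] with x hx
    simp [hx]

/-- The integral over `[0, 1]` of a smooth family of maps is smooth. -/
theorem contDiff_integral_zero_one {n : ℕ} {E F : Type} [NormedAddCommGroup E]
    [NormedSpace ℝ E] [FiniteDimensional ℝ E] [NormedAddCommGroup F] [NormedSpace ℝ F]
    {f : E × ℝ → F} (hf : ContDiff ℝ n f) :
    ContDiff ℝ n fun x => ∫ t in (0 : ℝ)..1, f (x, t) := by
  induction n generalizing F with
  | zero =>
    rw [Nat.cast_zero, contDiff_zero] at hf ⊢
    exact intervalIntegral.continuous_parametric_intervalIntegral_of_continuous'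
      (f := fun x t => f (x, t)) hf 0 1
  | succ n ih =>
    have hf1 : ContDiff ℝ 1 f := hf.of_le (by norm_cast; omega)
    let f' : E × ℝ → E →L[ℝ] F := fun y => (fderiv ℝ f y).comp (ContinuousLinearMap.inl ℝ E ℝ)
    have hf' : ContDiff ℝ n f' :=
      (hf.fderiv_right (m := n) (by norm_cast)).clm_comp contDiff_const
    have hder : ∀ x t, HasFDerivAt (fun x => f (x, t)) (f' (x, t)) x := fun x t =>
      ((hf1.differentiable one_ne_zero (x, t)).hasFDerivAt).comp x (hasFDerivAt_prodMk_left x t)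
    have key : ∀ x, HasFDerivAt (fun x => ∫ t in (0 : ℝ)..1, f (x, t))
        (∫ t in (0 : ℝ)..1, f' (x, t)) x := by
      intro x
      obtain ⟨C, hC⟩ := ((isCompact_closedBall x 1).prod (isCompact_Icc (a := (0 : ℝ)) (b := 1))
        ).exists_bound_of_continuousOn hf'.continuous.continuousOn
      refine intervalIntegral.hasFDerivAt_integral_of_dominated_of_fderiv_le
        (F := fun x t => f (x, t)) (F' := fun x t => f' (x, t)) (bound := fun _ => C)
        (Metric.closedBall_mem_nhds x one_pos) ?_ ?_ ?_ ?_ ?_ ?_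
      · exact Eventually.of_forall fun y =>
          (hf1.continuous.comp (by fun_prop : Continuous fun t : ℝ => (y, t))).aestronglyMeasurable
      · exact (hf1.continuous.comp
          (by fun_prop : Continuous fun t : ℝ => (x, t))).intervalIntegrable 0 1
      · exact (hf'.continuous.comp
          (by fun_prop : Continuous fun t : ℝ => (x, t))).aestronglyMeasurable
      · refine Eventually.of_forall fun t ht y hy => hC (y, t) ⟨hy, ?_⟩
        rw [Set.uIoc_of_le zero_le_one] at ht
        exact ⟨ht.1.le, ht.2⟩
      · exact intervalIntegrable_const
      · exact Eventually.of_forall fun t _ y _ => hder y t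
    have hfd : fderiv ℝ (fun x => ∫ t in (0 : ℝ)..1, f (x, t)) =
        fun x => ∫ t in (0 : ℝ)..1, f' (x, t) := funext fun x => (key x).fderiv
    push_cast
    rw [contDiff_succ_iff_fderiv]
    refine ⟨fun x => (key x).differentiableAt, by simp, ?_⟩
    rw [hfd]
    -- The induction hypothesis is used with codomain `E →L[ℝ] F`, so `F` is generalized and shares
    -- a universe with `E`.
    exact ih hf'

/-- **Hadamard's lemma** in the second variable. -/
theorem exists_eq_add_mul {f : ℝ × ℝ → ℝ} (hf : ContDiff ℝ ∞ f) :
    ∃ g : ℝ × ℝ → ℝ, ContDiff ℝ ∞ g ∧ ∀ q p, f (q, p) = f (q, 0) + p * g (q, p) := by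
  let d : (ℝ × ℝ) × ℝ → ℝ := fun y => fderiv ℝ f (y.1.1, y.2 * y.1.2) (0, 1)
  have hd : ContDiff ℝ ∞ d := by
    have := hf.fderiv_right (m := ∞) (by norm_cast)
    exact (this.comp (by fun_prop : ContDiff ℝ ∞
      fun y : (ℝ × ℝ) × ℝ => (y.1.1, y.2 * y.1.2))).clm_apply contDiff_const
  refine ⟨fun x => ∫ t in (0 : ℝ)..1, d (x, t), contDiff_infty.2 fun n =>
    contDiff_integral_zero_one (contDiff_infty.1 hd n), fun q p => ?_⟩
  have hder : ∀ t ∈ Set.uIcc (0 : ℝ) 1,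
      HasDerivAt (fun t : ℝ => f (q, t * p)) (p * d ((q, p), t)) t := by
    intro t _
    have h1 : HasDerivAt (fun t : ℝ => (q, t * p)) (0, p) t :=
      (hasDerivAt_const t q).prodMk (by simpa using (hasDerivAt_id t).mul_const p)
    have h2 := ((hf.differentiable (by simp) (q, t * p)).hasFDerivAt).comp_hasDerivAt t h1
    convert! h2 using 1
    have : ((0 : ℝ), p) = p • ((0 : ℝ), (1 : ℝ)) := by simp
    rw [this, map_smul, smul_eq_mul]
  have := intervalIntegral.integral_eq_sub_of_hasDerivAt hder
    ((continuous_const.mul (hd.continuous.comp (by fun_prop))).intervalIntegrable 0 1)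
  rw [intervalIntegral.integral_const_mul] at this
  simp only [one_mul, zero_mul] at this
  rw [this]; ring

theorem hasDerivAt_snd_of_contDiff {f : ℝ × ℝ → ℝ} (hf : ContDiff ℝ ∞ f) (q p : ℝ) :
    HasDerivAt (fun p => f (q, p)) (fderiv ℝ f (q, p) (0, 1)) p :=
  ((hf.differentiable (by simp) (q, p)).hasFDerivAt).comp_hasDerivAt p
    ((hasDerivAt_const p q).prodMk (hasDerivAt_id p))

/-- Second order Taylor formula in the second variable, with smooth remainder. -/
theorem exists_eq_add_mul_add_sq_mul {f : ℝ × ℝ → ℝ} (hf : ContDiff ℝ ∞ f) :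
    ∃ g : ℝ × ℝ → ℝ, ContDiff ℝ ∞ g ∧
      ∀ q p, f (q, p) = f (q, 0) + p * fderiv ℝ f (q, 0) (0, 1) + p ^ 2 * g (q, p) := by
  obtain ⟨g, hg, hfg⟩ := exists_eq_add_mul hf
  obtain ⟨k, hk, hgk⟩ := exists_eq_add_mul hg
  refine ⟨k, hk, fun q p => ?_⟩
  have h1 : HasDerivAt (fun p => f (q, 0) + p * g (q, p)) (g (q, 0)) 0 := by
    have := ((hasDerivAt_id (0 : ℝ)).mul (hasDerivAt_snd_of_contDiff hg q 0)).const_add (f (q, 0))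
    simpa using this
  have h2 : fderiv ℝ f (q, 0) (0, 1) = g (q, 0) :=
    (hasDerivAt_snd_of_contDiff hf q 0).unique (by simpa only [← hfg] using h1)
  rw [h2, hfg, hgk]; ring

/-! ### Taylor remainder and local inverses -/

theorem SmoothGerm.sub_taylorPolynomial_isLittleO {E : Type*} [NormedAddCommGroup E]
    [NormedSpace ℝ E] {f : E → ℝ} (hf : ContDiff ℝ ∞ f) (n : ℕ) :
    (fun x => f x - SmoothGerm.taylorPolynomial n f x) =o[𝓝 0] fun x => ‖x‖ ^ n := by
  have hcont : Continuous fun x => ‖iteratedFDeriv ℝ (n + 1) f x‖ :=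
    (hf.continuous_iteratedFDeriv (m := n + 1) (by exact_mod_cast le_top)).norm
  set C := ‖iteratedFDeriv ℝ (n + 1) f 0‖ + 1
  have hC : ∀ᶠ x in 𝓝 (0 : E), ‖iteratedFDeriv ℝ (n + 1) f x‖ < C :=
    hcont.continuousAt.eventually_lt continuousAt_const (by simp [C])
  obtain ⟨r, hr, hball⟩ := Metric.eventually_nhds_iff_ball.1 hC
  have hO : (fun x => f x - SmoothGerm.taylorPolynomial n f x) =O[𝓝 0]
      fun x => ‖x‖ ^ (n + 1) := by
    refine IsBigO.of_bound C ?_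
    filter_upwards [Metric.ball_mem_nhds (0 : E) hr] with x hx
    -- Restriction to the segment from `0` to `x` reduces the estimate to the one-variable Lagrange
    -- remainder.
    let φ : ℝ → ℝ := f ∘ ContinuousLinearMap.toSpanSingleton ℝ x
    have hφ : ContDiff ℝ ∞ φ := hf.comp (ContinuousLinearMap.contDiff _)
    have hder : ∀ k t, iteratedDeriv k φ t = iteratedFDeriv ℝ k f (t • x) fun _ => x := by
      intro k t
      rw [iteratedDeriv_eq_iteratedFDeriv,
        ContinuousLinearMap.iteratedFDeriv_comp_right _ hf _ (by exact_mod_cast le_top)]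
      simp
    obtain ⟨t, ht, h⟩ := taylor_mean_remainder_lagrange_iteratedDeriv (f := φ) (n := n)
      (zero_ne_one (α := ℝ)) (contDiff_infty.1 hφ (n + 1)).contDiffOn
    have hT : taylorWithinEval φ n (Set.uIcc 0 1) 0 1 = SmoothGerm.taylorPolynomial n f x := by
      rw [taylor_within_apply, SmoothGerm.taylorPolynomial]
      refine Finset.sum_congr rfl fun k _ => ?_
      rw [iteratedDerivWithin_eq_iteratedDeriv (uniqueDiffOn_uIcc zero_ne_one)
        (contDiff_infty.1 hφ k).contDiffAt Set.left_mem_uIcc, hder]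
      simp
    have ht' : t ∈ Set.Ioo (0 : ℝ) 1 := by simpa [Set.uIoo] using ht
    have htx : t • x ∈ Metric.ball (0 : E) r := by
      rw [mem_ball_zero_iff] at hx ⊢
      rw [norm_smul, Real.norm_of_nonneg ht'.1.le]
      nlinarith [norm_nonneg x, ht'.2]
    have hfx : f x - SmoothGerm.taylorPolynomial n f x =
        (iteratedFDeriv ℝ (n + 1) f (t • x) fun _ => x) / (n + 1).factorial := by
      rw [← hT, ← hder]
      simpa [φ] using h
    rw [hfx, norm_div, Real.norm_natCast, norm_pow, norm_norm]
    refine (div_le_self (norm_nonneg _) (by exact_mod_cast Nat.factorial_pos _)).trans ?_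
    refine (ContinuousMultilinearMap.le_opNorm _ _).trans ?_
    simp only [Finset.prod_const, Finset.card_univ, Fintype.card_fin]
    gcongr
    exact (hball _ htx).le
  refine hO.trans_isLittleO ?_
  have : (fun x : E => ‖x‖) =o[𝓝 0] fun _ => (1 : ℝ) := by
    rw [isLittleO_one_iff]; exact tendsto_norm_zero
  simpa [pow_succ] using (isBigO_refl (fun x : E => ‖x‖ ^ n) _).mul_isLittleO this

/-- Inverse function theorem for maps smooth near the origin and tangent to the identity. -/
theorem exists_local_inverse_of_isLittleO {E : Type*} [NormedAddCommGroup E] [NormedSpace ℝ E]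
    [CompleteSpace E] {f : E → E} (hf : ∀ᶠ x in 𝓝 0, ContDiffAt ℝ ∞ f x)
    (hf' : (fun x => f x - x) =o[𝓝 0] fun x => x) :
    ∃ g : E → E, (∀ᶠ x in 𝓝 0, ContDiffAt ℝ ∞ g x) ∧ g 0 = 0 ∧
      (∀ᶠ x in 𝓝 0, f (g x) = x) ∧ ∀ᶠ x in 𝓝 0, g (f x) = x := by
  have h0 : f 0 = 0 := by
    have := (hf'.def one_pos).self_of_nhds
    simpa using this
  have hd : HasFDerivAt f ((ContinuousLinearEquiv.refl ℝ E : E ≃L[ℝ] E) : E →L[ℝ] E) 0 := by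
    rw [hasFDerivAt_iff_isLittleO_nhds_zero]
    simpa [h0] using hf'
  have hfa := hf.self_of_nhds
  have hn : (∞ : WithTop ℕ∞) ≠ 0 := by simp
  let e := hfa.toOpenPartialHomeomorph f hd hn
  have he : (e : E → E) = f := rfl
  have h0s : (0 : E) ∈ e.source := hfa.mem_toOpenPartialHomeomorph_source hd hn
  have h0t : (0 : E) ∈ e.target := by
    have := e.map_source h0s
    rwa [he, h0] at this
  have hs0 : e.symm 0 = 0 := by
    have := e.left_inv h0s
    rwa [he, h0] at this
  have hcont : Tendsto e.symm (𝓝 0) (𝓝 0) := by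
    have := e.continuousAt_symm h0t
    rwa [ContinuousAt, hs0] at this
  have hinv : ∀ᶠ x in 𝓝 (0 : E), ∃ L : E ≃L[ℝ] E, (L : E →L[ℝ] E) = fderiv ℝ f x := by
    have hc : ContinuousAt (fderiv ℝ f) 0 := hfa.continuousAt_fderiv (by simp)
    refine hc.eventually (p := fun T => ∃ L : E ≃L[ℝ] E, (L : E →L[ℝ] E) = T) ?_
    rw [hd.fderiv]
    exact ContinuousLinearEquiv.nhds _
  refine ⟨e.symm, ?_, hs0, ?_, ?_⟩
  · filter_upwards [e.open_target.mem_nhds h0t, hcont.eventually hinv, hcont.eventually hf]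
      with y hy ⟨L, hL⟩ hfy
    refine e.contDiffAt_symm (f₀' := L) hy ?_ hfy
    rw [hL]
    exact (hfy.differentiableAt hn).hasFDerivAt
  · filter_upwards [e.open_target.mem_nhds h0t] with y hy using e.right_inv hy
  · filter_upwards [e.open_source.mem_nhds h0s] with y hy using e.left_inv hy

/-! ### Orders of vanishing in one variable -/

theorem isLittleO_of_pow_mul_isLittleO {r : ℝ → ℝ} {m n : ℕ}
    (h : (fun x => x ^ m * r x) =o[𝓝[≠] 0] fun x : ℝ => x ^ (m + n)) :
    r =o[𝓝[≠] 0] fun x : ℝ => x ^ n := by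
  have := (isBigO_refl (fun x : ℝ => (x ^ m)⁻¹) (𝓝[≠] 0)).mul_isLittleO h
  refine this.congr' ?_ ?_ <;> filter_upwards [self_mem_nhdsWithin] with x (hx : x ≠ 0)
  · field_simp
  · field_simp
    ring

theorem eq_zero_of_isLittleO_pow {r : ℝ → ℝ} {n : ℕ} (hr : ContinuousAt r 0)
    (h : r =o[𝓝[≠] 0] fun x : ℝ => x ^ n) : r 0 = 0 := by
  have h1 : (fun x : ℝ => x ^ n) =O[𝓝[≠] 0] fun _ => (1 : ℝ) :=
    ((continuous_pow n).continuousAt.tendsto.mono_left nhdsWithin_le_nhds).isBigO_one ℝ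
  exact tendsto_nhds_unique (hr.tendsto.mono_left nhdsWithin_le_nhds)
    ((isLittleO_one_iff ℝ).1 (h.trans_isBigO h1))

/-- Each induction step reads off `k 0 = 0` and divides by `x` using Hadamard's lemma, which keeps
the quotient smooth. -/
theorem exists_eq_pow_mul_of_isLittleO {n : ℕ} {c : ℝ} {k : ℝ → ℝ} (hk : ContDiff ℝ ∞ k)
    (h : (fun x => k x - c * x ^ n) =o[𝓝[≠] 0] fun x : ℝ => x ^ n) :
    ∃ u : ℝ → ℝ, ContDiff ℝ ∞ u ∧ u 0 = c ∧ ∀ x, k x = x ^ n * u x := by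
  induction n generalizing k with
  | zero =>
    have := hk.continuous
    have h0 := eq_zero_of_isLittleO_pow (by fun_prop) h
    exact ⟨k, hk, by simpa [sub_eq_zero] using h0, by simp⟩
  | succ n ih =>
    have := hk.continuous
    have h0 := eq_zero_of_isLittleO_pow (by fun_prop) h
    replace h0 : k 0 = 0 := by simpa using h0
    obtain ⟨g, hg, hkg⟩ := exists_eq_add_mul (f := fun x : ℝ × ℝ => k x.2) (by fun_prop)
    replace hkg : ∀ x, k x = x * g (0, x) := fun x => by simpa [h0] using hkg 0 x
    obtain ⟨u, hu, hu0, hgu⟩ := ih (k := fun x => g (0, x)) (by fun_prop) <| by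
      refine isLittleO_of_pow_mul_isLittleO (m := 1) ?_
      refine h.congr (fun x => ?_) fun x => by rw [add_comm]
      rw [hkg]; ring
    exact ⟨u, hu, hu0, fun x => by rw [hkg, hgu]; ring⟩

theorem eq_of_quadratic_isLittleO {A B α : ℝ} {m : ℝ → ℝ} (hm : Continuous m)
    (h : (fun x => A + x * B + x ^ 2 * m x - α * x ^ 2) =o[𝓝[≠] 0] fun x : ℝ => x ^ 2) :
    A = 0 ∧ B = 0 ∧ m 0 = α := by
  have hA := eq_zero_of_isLittleO_pow (by fun_prop) h
  replace hA : A = 0 := by simpa using hA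
  have h1 : (fun x => B + x * m x - α * x) =o[𝓝[≠] 0] fun x : ℝ => x ^ 1 :=
    isLittleO_of_pow_mul_isLittleO (m := 1) (h.congr_left fun x => by rw [hA]; ring)
  have hB := eq_zero_of_isLittleO_pow (by fun_prop) h1
  replace hB : B = 0 := by simpa using hB
  have h2 : (fun x => m x - α) =o[𝓝[≠] 0] fun x : ℝ => x ^ 0 :=
    isLittleO_of_pow_mul_isLittleO (m := 1) (h1.congr_left fun x => by rw [hB]; ring)
  have hm0 := eq_zero_of_isLittleO_pow (by fun_prop) h2
  exact ⟨hA, hB, by simpa [sub_eq_zero] using hm0⟩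

theorem isLittleO_nhds_of_nhdsNE {f g : ℝ → ℝ} (h : f =o[𝓝[≠] 0] g) (h0 : f 0 = 0) :
    f =o[𝓝 0] g := by
  refine IsLittleO.of_bound fun C hC => ?_
  have := h.def hC
  rw [eventually_nhdsWithin_iff] at this
  filter_upwards [this] with x hx
  by_cases h' : x = 0
  · subst h'
    rw [h0, norm_zero]
    positivity
  · exact hx h'

/-! ### Splitting off the quadratic variable -/

/-- The first order coefficient in `p` of a function with `6`-jet `α p² + h(q)` is `o(q³)`. -/
theorem fderiv_snd_isLittleO {α : ℝ} {f : ℝ × ℝ → ℝ} {h : ℝ → ℝ}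
    {g : ℝ × ℝ → ℝ} (hg : ContDiff ℝ ∞ g) (hg0 : g 0 = α)
    (hfg : ∀ q p, f (q, p) = f (q, 0) + p * fderiv ℝ f (q, 0) (0, 1) + p ^ 2 * g (q, p))
    (hfh : (fun x => f x - (α * x.2 ^ 2 + h x.1)) =o[𝓝 0] fun x => ‖x‖ ^ 6) :
    (fun q : ℝ => fderiv ℝ f (q, 0) (0, 1)) =o[𝓝[≠] 0] fun q : ℝ => q ^ 3 := by
  -- On the curves `p = c q³` the term `α p²` has order 6, like the error. Subtracting the cases `c
  -- = 1` and `c = 0` isolates `q³ ∂f/∂p (q, 0)` up to `o(q⁶)`.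
  have along : ∀ c : ℝ, (fun q : ℝ => f (q, c * q ^ 3) - (α * (c * q ^ 3) ^ 2 + h q))
      =o[𝓝 0] fun q => q ^ 6 := by
    intro c
    have ht : Tendsto (fun q : ℝ => (q, c * q ^ 3)) (𝓝 0) (𝓝 0) := by
      have : Continuous fun q : ℝ => (q, c * q ^ 3) := by fun_prop
      exact this.tendsto' 0 0 (by simp)
    have hO : (fun q : ℝ => (q, c * q ^ 3)) =O[𝓝 0] fun q => q := by
      refine (isBigO_refl _ _).prod_left ?_
      have : (fun q : ℝ => c * q ^ 2) =O[𝓝 0] fun _ => (1 : ℝ) :=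
        ((by fun_prop : Continuous fun q : ℝ => c * q ^ 2).tendsto 0).isBigO_one ℝ
      refine (this.mul (isBigO_refl (fun q : ℝ => q) _)).congr (fun q => by ring) fun q => one_mul q
    exact (hfh.comp_tendsto ht).trans_isBigO (hO.norm_left.pow 6)
  have hgq : (fun q : ℝ => α - g (q, q ^ 3)) =o[𝓝 0] fun _ => (1 : ℝ) := by
    rw [isLittleO_one_iff]
    have hgc := hg.continuous
    have : Continuous fun q : ℝ => α - g (q, q ^ 3) := by fun_prop
    have h2 := this.tendsto 0
    have h3 : g (0, 0) = α := hg0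
    simpa [h3] using h2
  refine isLittleO_of_pow_mul_isLittleO (m := 3) (n := 3) (IsLittleO.mono ?_ nhdsWithin_le_nhds)
  have h6 := (isBigO_refl (fun q : ℝ => q ^ 6) (𝓝 0)).mul_isLittleO hgq
  simp only [mul_one] at h6
  refine (((along 1).sub (along 0)).add h6).congr_left fun q => ?_
  simp only [one_mul, zero_mul]
  rw [hfg q (q ^ 3)]
  ring

/-- The critical points in the second variable form a smooth curve, flat to the order of the
first order coefficient. -/
theorem exists_critical_curve {α : ℝ} (hα : α ≠ 0) {f : ℝ × ℝ → ℝ} (hf : ContDiff ℝ ∞ f)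
    {g : ℝ × ℝ → ℝ} (hg : ContDiff ℝ ∞ g) (hg0 : g 0 = α)
    (hfg : ∀ q p, f (q, p) = f (q, 0) + p * fderiv ℝ f (q, 0) (0, 1) + p ^ 2 * g (q, p))
    (h1 : (fun q : ℝ => fderiv ℝ f (q, 0) (0, 1)) =o[𝓝[≠] 0] fun q : ℝ => q ^ 3) :
    ∃ s : ℝ → ℝ, ContDiff ℝ ∞ s ∧ s 0 = 0 ∧ s =o[𝓝 0] (fun q : ℝ => q ^ 3) ∧
      ∀ᶠ q in 𝓝 (0 : ℝ), fderiv ℝ f (q, s q) (0, 1) = 0 := by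
  set d : ℝ × ℝ → ℝ := fun x => fderiv ℝ f x (0, 1) with hd
  have hdc : ContDiff ℝ ∞ d := (hf.fderiv_right (m := ∞) (by norm_cast)).clm_apply contDiff_const
  have hd0 : d (0, 0) = 0 := by
    have := hdc.continuous
    exact eq_zero_of_isLittleO_pow (r := fun q => d (q, 0)) (by fun_prop) h1
  have h1' := isLittleO_nhds_of_nhdsNE h1 hd0
  -- Differentiating `hfg` in `p` gives `d (q, p) = d (q, 0) + p * w (q, p)`.
  let w : ℝ × ℝ → ℝ := fun x => 2 * g x + x.2 * fderiv ℝ g x (0, 1)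
  have hwc : ContDiff ℝ ∞ w :=
    (contDiff_const.mul hg).add (contDiff_snd.mul
      ((hg.fderiv_right (m := ∞) (by norm_cast)).clm_apply contDiff_const))
  have hw0 : w 0 = 2 * α := by simp [w, hg0]
  have hdw : ∀ x : ℝ × ℝ, d x = d (x.1, 0) + x.2 * w x := by
    rintro ⟨q, p⟩
    have e1 := hasDerivAt_snd_of_contDiff hf q p
    have e2 : HasDerivAt (fun p => f (q, 0) + p * d (q, 0) + p ^ 2 * g (q, p))
        (d (q, 0) + p * w (q, p)) p := by
      have := (((hasDerivAt_id p).mul_const (d (q, 0))).const_add (f (q, 0))).add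
        (((hasDerivAt_id p).pow 2).mul (hasDerivAt_snd_of_contDiff hg q p))
      convert! this using 1
      simp [w]; ring
    exact e1.unique (by rw [funext (hfg q)]; exact e2)
  have hwlim : (fun x => w x - 2 * α) =o[𝓝 0] fun _ => (1 : ℝ) := by
    rw [isLittleO_one_iff]
    have := (hwc.continuous.sub continuous_const).tendsto (0 : ℝ × ℝ) (f := fun x => w x - 2 * α)
    simpa [hw0] using this
  have hfst : (fun x : ℝ × ℝ => x.1) =O[𝓝 0] fun x => x := isBigO_fst_prod'
  have hsnd : (fun x : ℝ × ℝ => x.2) =O[𝓝 0] fun x => x := isBigO_snd_prod'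
  have hcube : (fun q : ℝ => q ^ 3) =O[𝓝 0] fun q => q := by
    have : (fun q : ℝ => q ^ 2) =O[𝓝 0] fun _ => (1 : ℝ) :=
      ((continuous_pow 2).tendsto (0 : ℝ)).isBigO_one ℝ
    exact (this.mul (isBigO_refl (fun q : ℝ => q) _)).congr (fun q => by ring) fun q => one_mul q
  -- The factor `(2 * α)⁻¹` makes `Ψ` tangent to the identity, since `w 0 = 2 * α`. The critical
  -- curve is the preimage of the axis `p = 0` under `Ψ`.
  let Ψ : ℝ × ℝ → ℝ × ℝ := fun x => (x.1, (2 * α)⁻¹ * d x)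
  have hΨ : ContDiff ℝ ∞ Ψ := contDiff_fst.prodMk (contDiff_const.mul hdc)
  have hΨ' : (fun x => Ψ x - x) =o[𝓝 0] fun x => x := by
    have e1 : (fun x : ℝ × ℝ => d (x.1, 0)) =o[𝓝 0] fun x => x := by
      have := h1'.trans_isBigO hcube
      exact (this.comp_tendsto (continuous_fst.tendsto (0 : ℝ × ℝ))).trans_isBigO hfst
    have e2 : (fun x : ℝ × ℝ => x.2 * (w x - 2 * α)) =o[𝓝 0] fun x => x := by
      have := hsnd.norm_right.mul_isLittleO hwlim
      simp only [mul_one] at this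
      exact this.of_norm_right
    have e3 := (e1.add e2).const_mul_left (2 * α)⁻¹
    refine ((isLittleO_zero (E' := ℝ) (fun x : ℝ × ℝ => x) (𝓝 0)).prod_left e3).congr_left ?_
    intro x
    ext
    · simp [Ψ]
    · simp only [Ψ, Prod.snd_sub]
      rw [hdw x]
      field_simp
      ring
  obtain ⟨Θ, hΘ, hΘ0, hΨΘ, -⟩ := exists_local_inverse_of_isLittleO
    (Eventually.of_forall fun x => hΨ.contDiffAt) hΨ'
  have hι : Tendsto (fun q : ℝ => (q, (0 : ℝ))) (𝓝 0) (𝓝 0) :=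
    (by fun_prop : Continuous fun q : ℝ => (q, (0 : ℝ))).tendsto 0
  obtain ⟨s, hs, hsΘ⟩ := exists_contDiff_eventuallyEq (f := fun q : ℝ => (Θ (q, 0)).2) <| by
    filter_upwards [hι.eventually hΘ] with q hq
    exact contDiffAt_snd.comp q (hq.comp q (by fun_prop))
  have hs0 : s 0 = 0 := by
    have := hsΘ.self_of_nhds
    simpa [← Prod.zero_eq_mk, hΘ0] using this
  have hcrit : ∀ᶠ q in 𝓝 (0 : ℝ), d (q, s q) = 0 := by
    filter_upwards [hsΘ, hι.eventually hΨΘ] with q hq hq'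
    have e1 : (Θ (q, 0)).1 = q := congrArg Prod.fst hq'
    have e2 : (2 * α)⁻¹ * d (Θ (q, 0)) = 0 := congrArg Prod.snd hq'
    have e3 : Θ (q, 0) = (q, s q) := Prod.ext e1 hq.symm
    rw [e3] at e2
    simpa [hα] using e2
  refine ⟨s, hs, hs0, ?_, hcrit⟩
  have hsc := hs.continuous
  have hwcc := hwc.continuous
  have hws : ContinuousAt (fun q => w (q, s q)) 0 := by fun_prop
  have hws0 : w (0, s 0) ≠ 0 := by
    rw [hs0]
    change w 0 ≠ 0
    rw [hw0]; simpa using hα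
  have hinv : (fun q => (w (q, s q))⁻¹) =O[𝓝 0] fun _ => (1 : ℝ) :=
    (hws.inv₀ hws0).tendsto.isBigO_one ℝ
  have := (hinv.mul_isLittleO h1').neg_left
  simp only [one_mul] at this
  -- On the critical curve `d (q, 0) + s q * w (q, s q) = 0`, so `s` inherits the order of `d (q,
  -- 0)`.
  refine this.congr' ?_ EventuallyEq.rfl
  filter_upwards [hcrit, hws.eventually_ne hws0] with q hq hq'
  have := hdw (q, s q)
  rw [hq] at this
  simp only at this
  change -((w (q, s q))⁻¹ * d (q, 0)) = s q
  field_simp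
  linarith

/-- A smooth function with value `1` at the origin has smooth `n`-th roots near the origin. -/
theorem exists_local_root {E : Type*} [NormedAddCommGroup E] [NormedSpace ℝ E] {n : ℕ}
    (hn : n ≠ 0) {V : E → ℝ} (hV : ContDiff ℝ ∞ V) (hV0 : V 0 = 1) :
    ∃ r : E → ℝ, (∀ᶠ x in 𝓝 0, ContDiffAt ℝ ∞ r x) ∧ (fun x => r x - 1) =o[𝓝 0] (fun _ => (1 : ℝ)) ∧
      ∀ᶠ x in 𝓝 0, r x ^ n = V x := by
  have hpos : ∀ᶠ x in 𝓝 0, 0 < V x :=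
    hV.continuous.continuousAt.eventually_const_lt (by simp [hV0])
  have hr : ∀ᶠ x in 𝓝 0, ContDiffAt ℝ ∞ (fun x => V x ^ ((n : ℝ)⁻¹)) x := by
    filter_upwards [hpos] with x hx using hV.contDiffAt.rpow_const_of_ne hx.ne'
  refine ⟨fun x => V x ^ ((n : ℝ)⁻¹), hr, ?_, ?_⟩
  · rw [isLittleO_one_iff]
    simpa [hV0] using hr.self_of_nhds.continuousAt.tendsto.sub_const 1
  · filter_upwards [hpos] with x hx using Real.rpow_inv_natCast_pow hx.le hn

/-- A function whose `6`-jet is that of `α p² + h(q)`, with `h` of order `n ≤ 6`, is brought to the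
form `α p² + c qⁿ` by a change of coordinates tangent to the identity. -/
theorem exists_normal_form {α c : ℝ} {n : ℕ} (hα : α ≠ 0) (hc : c ≠ 0) (hn : n ≠ 0) (hn6 : n ≤ 6)
    {f : ℝ × ℝ → ℝ} {h : ℝ → ℝ} (hf : ContDiff ℝ ∞ f)
    (hfh : (fun x => f x - (α * x.2 ^ 2 + h x.1)) =o[𝓝 0] fun x => ‖x‖ ^ 6)
    (hh : (fun q => h q - c * q ^ n) =o[𝓝[≠] 0] fun q : ℝ => q ^ n) :
    ∃ Φ : ℝ × ℝ → ℝ × ℝ, (∀ᶠ x in 𝓝 0, ContDiffAt ℝ ∞ Φ x) ∧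
      (fun x => Φ x - x) =o[𝓝 0] (fun x => x) ∧
      ∀ᶠ x in 𝓝 0, f x = α * (Φ x).2 ^ 2 + c * (Φ x).1 ^ n := by
  have hpow : ∀ {m : ℕ}, m ≤ 6 → (fun q : ℝ => q ^ 6) =O[𝓝 0] fun q : ℝ => q ^ m := by
    intro m hm
    have h1 : (fun q : ℝ => q ^ (6 - m)) =O[𝓝 0] fun _ => (1 : ℝ) :=
      ((continuous_pow (6 - m)).tendsto (0 : ℝ)).isBigO_one ℝ
    refine (h1.mul (isBigO_refl (fun q : ℝ => q ^ m) _)).congr (fun q => ?_) fun q => one_mul _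
    rw [← pow_add, Nat.sub_add_cancel hm]
  have hvert : (fun p : ℝ => f (0, p) - (α * p ^ 2 + h 0)) =o[𝓝[≠] 0] fun p => p ^ 2 := by
    have ht : Tendsto (fun p : ℝ => ((0 : ℝ), p)) (𝓝 0) (𝓝 0) :=
      (by fun_prop : Continuous fun p : ℝ => ((0 : ℝ), p)).tendsto 0
    have hO : (fun p : ℝ => ((0 : ℝ), p)) =O[𝓝 0] fun p => p :=
      (isBigO_zero _ _).prod_left (isBigO_refl _ _)
    exact (((hfh.comp_tendsto ht).trans_isBigO (hO.norm_left.pow 6)).trans_isBigO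
      (hpow (by norm_num))).mono nhdsWithin_le_nhds
  have hhor : (fun q : ℝ => f (q, 0) - h q) =o[𝓝 0] fun q => q ^ 6 := by
    have ht : Tendsto (fun q : ℝ => (q, (0 : ℝ))) (𝓝 0) (𝓝 0) :=
      (by fun_prop : Continuous fun q : ℝ => (q, (0 : ℝ))).tendsto 0
    have hO : (fun q : ℝ => (q, (0 : ℝ))) =O[𝓝 0] fun q => q :=
      (isBigO_refl _ _).prod_left (isBigO_zero _ _)
    refine ((hfh.comp_tendsto ht).trans_isBigO (hO.norm_left.pow 6)).congr_left fun q => ?_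
    simp
  obtain ⟨g, hg, hfg⟩ := exists_eq_add_mul_add_sq_mul hf
  have hg0 : g 0 = α := by
    have := hg.continuous
    refine (eq_of_quadratic_isLittleO (A := f (0, 0) - h 0)
      (B := fderiv ℝ f (0, 0) (0, 1)) (m := fun p => g (0, p))
      (by fun_prop) (hvert.congr_left fun p => ?_)).2.2
    rw [hfg 0 p]; ring
  obtain ⟨s, hs, hs0, hso, hcrit⟩ := exists_critical_curve hα hf hg hg0 hfg
    (fderiv_snd_isLittleO hg hg0 hfg hfh)
  have hsc := hs.continuous
  -- The shear moves the critical curve to the axis, so the linear term in `p` of the Taylor formula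
  -- vanishes there.
  have hF : ContDiff ℝ ∞ fun x : ℝ × ℝ => f (x.1, s x.1 + x.2) := by fun_prop
  obtain ⟨G, hG, hFG⟩ := exists_eq_add_mul_add_sq_mul hF
  have hGc := hG.continuous
  have hG0 : G 0 = α := by
    refine (eq_of_quadratic_isLittleO (A := f (0, 0) - h 0)
      (B := fderiv ℝ (fun x : ℝ × ℝ => f (x.1, s x.1 + x.2)) (0, 0) (0, 1)) (m := fun p => G (0, p))
      (by fun_prop) (hvert.congr_left fun p => ?_)).2.2
    have := hFG 0 p
    simp only [hs0, zero_add] at this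
    rw [this]; ring
  have hsplit : ∀ᶠ q in 𝓝 (0 : ℝ), ∀ p,
      f (q, p) = f (q, s q) + (p - s q) ^ 2 * G (q, p - s q) := by
    filter_upwards [hcrit] with q hq p
    have e1 := hasDerivAt_snd_of_contDiff hF q 0
    have e2 : HasDerivAt (fun p => f (q, s q + p)) 0 0 := by
      have := hasDerivAt_snd_of_contDiff hf q (s q + 0)
      rw [add_zero, hq, ← add_zero (s q)] at this
      exact this.comp_const_add (s q) 0
    have := hFG q (p - s q)
    rw [e1.unique e2] at this
    simpa using this
  have hk : (fun q => f (q, s q) - c * q ^ n) =o[𝓝[≠] 0] fun q : ℝ => q ^ n := by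
    have hGb : (fun q => G (q, -s q)) =O[𝓝 0] fun _ => (1 : ℝ) :=
      ((by fun_prop : Continuous fun q => G (q, -s q)).tendsto (0 : ℝ)).isBigO_one ℝ
    -- This is `f (q, 0) - f (q, s q)`, near the origin; `s = o(q³)` is just enough to make it
    -- `o(q⁶)`.
    have e1 : (fun q => s q ^ 2 * G (q, -s q)) =o[𝓝 0] fun q : ℝ => q ^ 6 :=
      ((hso.pow two_pos).mul_isBigO hGb).congr_right fun q => by ring
    have e2 := ((hhor.sub e1).trans_isBigO (hpow hn6)).mono
      (nhdsWithin_le_nhds (s := {(0 : ℝ)}ᶜ))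
    refine (e2.add hh).congr' ?_ EventuallyEq.rfl
    filter_upwards [nhdsWithin_le_nhds hsplit] with q hq
    rw [hq 0]
    simp only [zero_sub, neg_sq]
    ring
  obtain ⟨u, hu, hu0, hku⟩ := exists_eq_pow_mul_of_isLittleO (by fun_prop) hk
  -- Dividing by `c`, and below by `α`, gives units equal to `1` at the origin, so roots exist
  -- whatever the signs of `c` and `α`.
  obtain ⟨r₁, hr₁, hr₁o, hr₁u⟩ := exists_local_root hn
    (V := fun x : ℝ × ℝ => c⁻¹ * u x.1) (by fun_prop) (by simp [hu0, hc])
  obtain ⟨r₂, hr₂, hr₂o, hr₂G⟩ := exists_local_root two_ne_zero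
    (V := fun x : ℝ × ℝ => α⁻¹ * G (x.1, x.2 - s x.1)) (by fun_prop) (by
      have : G (0, 0) = α := hG0
      simp [hs0, this, hα])
  have hfst : (fun x : ℝ × ℝ => x.1) =O[𝓝 0] fun x => x := isBigO_fst_prod'
  have hsnd : (fun x : ℝ × ℝ => x.2) =O[𝓝 0] fun x => x := isBigO_snd_prod'
  have hso' : (fun x : ℝ × ℝ => s x.1) =o[𝓝 0] fun x => x := by
    have h1 : (fun q : ℝ => q ^ 3) =O[𝓝 0] fun q => q := by
      have : (fun q : ℝ => q ^ 2) =O[𝓝 0] fun _ => (1 : ℝ) :=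
        ((continuous_pow 2).tendsto (0 : ℝ)).isBigO_one ℝ
      exact (this.mul (isBigO_refl (fun q : ℝ => q) _)).congr (fun q => by ring) fun q => one_mul q
    exact ((hso.trans_isBigO h1).comp_tendsto (continuous_fst.tendsto (0 : ℝ × ℝ))).trans_isBigO hfst
  refine ⟨fun x => (x.1 * r₁ x, (x.2 - s x.1) * r₂ x), ?_, ?_, ?_⟩
  · filter_upwards [hr₁, hr₂] with x h1 h2
    exact (contDiffAt_fst.mul h1).prodMk
      ((contDiffAt_snd.sub (hs.contDiffAt.comp x contDiffAt_fst)).mul h2)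
  · have e1 := hfst.norm_right.mul_isLittleO hr₁o
    have e2 := ((hsnd.sub hso'.isBigO).norm_right.mul_isLittleO hr₂o)
    simp only [mul_one] at e1 e2
    refine (e1.of_norm_right.prod_left (e2.of_norm_right.sub hso')).congr_left fun x => ?_
    ext
    · simp only [Prod.fst_sub]; ring
    · simp only [Prod.snd_sub]; ring
  · filter_upwards [hr₁u, hr₂G, (continuous_fst.tendsto (0 : ℝ × ℝ)).eventually hsplit]
      with x h1 h2 h3
    have := h3 x.2
    rw [Prod.mk.eta, hku] at this
    rw [this, mul_pow, mul_pow, h1, h2]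
    field_simp
    ring

/-! ### From a common normal form to determinacy -/

/-- Two functions with a common normal form near the origin have equivalent germs. -/
theorem SmoothGerm.equivalent_of_comp_eq {E : Type*} [NormedAddCommGroup E] [NormedSpace ℝ E]
    [CompleteSpace E] {G : Type*} [NormedAddCommGroup G] {f₁ f₂ N : E → G} {Φ₁ Φ₂ : E → E}
    (h₁ : ∀ᶠ x in 𝓝 0, ContDiffAt ℝ ∞ Φ₁ x) (h₁' : (fun x => Φ₁ x - x) =o[𝓝 0] fun x => x)
    (h₂ : ∀ᶠ x in 𝓝 0, ContDiffAt ℝ ∞ Φ₂ x) (h₂' : (fun x => Φ₂ x - x) =o[𝓝 0] fun x => x)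
    (hf₁ : ∀ᶠ x in 𝓝 0, f₁ x = N (Φ₁ x)) (hf₂ : ∀ᶠ x in 𝓝 0, f₂ x = N (Φ₂ x)) :
    Equivalent (germAtZero f₁) (germAtZero f₂) := by
  have zero_of {Φ : E → E} (h : (fun x => Φ x - x) =o[𝓝 0] fun x => x) : Φ 0 = 0 := by
    simpa using (h.def one_pos).self_of_nhds
  have tendsto_of {Φ : E → E} (h : ∀ᶠ x in 𝓝 0, ContDiffAt ℝ ∞ Φ x) (h0 : Φ 0 = 0) :
      Tendsto Φ (𝓝 0) (𝓝 0) := by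
    have := h.self_of_nhds.continuousAt.tendsto
    rwa [h0] at this
  have hΦ₁ := tendsto_of h₁ (zero_of h₁')
  have hΦ₂ := tendsto_of h₂ (zero_of h₂')
  obtain ⟨Θ₁, hs₁, hz₁, hr₁, hl₁⟩ := exists_local_inverse_of_isLittleO h₁ h₁'
  obtain ⟨Θ₂, hs₂, hz₂, hr₂, hl₂⟩ := exists_local_inverse_of_isLittleO h₂ h₂'
  have hΘ₁ := tendsto_of hs₁ hz₁
  have hΘ₂ := tendsto_of hs₂ hz₂
  have hg : Tendsto (Θ₁ ∘ Φ₂) (𝓝 0) (𝓝 0) := hΘ₁.comp hΦ₂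
  have hh : Tendsto (Θ₂ ∘ Φ₁) (𝓝 0) (𝓝 0) := hΘ₂.comp hΦ₁
  refine ⟨germAtZero (Θ₁ ∘ Φ₂), germAtZero (Θ₂ ∘ Φ₁), hg, hh, ⟨_, ?_, rfl⟩, ⟨_, ?_, rfl⟩,
    Germ.coe_eq.2 ?_, Germ.coe_eq.2 ?_, Germ.coe_eq.2 ?_⟩
  · filter_upwards [h₂, hΦ₂.eventually hs₁] with x h h' using h'.comp x h
  · filter_upwards [h₁, hΦ₁.eventually hs₂] with x h h' using h'.comp x h
  · filter_upwards [hΦ₁.eventually hr₂, hl₁] with x h h'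
    simp [h, h']
  · filter_upwards [hΦ₂.eventually hr₁, hl₂] with x h h'
    simp [h, h']
  · filter_upwards [hg.eventually hf₁, hΦ₂.eventually hr₁, hf₂] with x h h' h''
    simp only [Function.comp_apply] at h ⊢
    rw [h, h', h'']

/-- The leading term is that of the lowest power with nonzero coefficient; `C ≠ 0` ensures there is
one. -/
theorem exists_leading_term (A B : ℝ) {C : ℝ} (hC : C ≠ 0) :
    ∃ (c : ℝ) (n : ℕ), c ≠ 0 ∧ n ≠ 0 ∧ n ≤ 6 ∧
      (fun q : ℝ => (C * q ^ 6 + A * q ^ 2 + B * q ^ 4) - c * q ^ n) =o[𝓝[≠] 0]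
        fun q : ℝ => q ^ n := by
  have key : ∀ {m n : ℕ} (D : ℝ), n < m → (fun q : ℝ => D * q ^ m) =o[𝓝[≠] 0] fun q => q ^ n :=
    fun D h => ((isLittleO_pow_pow h).const_mul_left D).mono nhdsWithin_le_nhds
  by_cases hA : A = 0
  · by_cases hB : B = 0
    · refine ⟨C, 6, hC, by norm_num, le_rfl, ?_⟩
      simp [hA, hB]
    · refine ⟨B, 4, hB, by norm_num, by norm_num, ?_⟩
      refine (key (m := 6) C (by norm_num)).congr_left fun q => ?_
      rw [hA]; ring
  · refine ⟨A, 2, hA, by norm_num, by norm_num, ?_⟩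
    refine ((key (m := 6) C (by norm_num)).add (key (m := 4) B (by norm_num))).congr_left
      fun q => ?_
    ring

theorem mainTheorem2 (a b : ℝ) (ha : a ≠ 0) (hb : b ≠ 0)
    (ν₁ ν₂ : ℝ × ℝ → ℝ) (hν₁ : ContDiff ℝ ∞ ν₁) (hν₂ : ContDiff ℝ ∞ ν₂)
    (hν₁0 : ν₁ (0, 0) = 0) (hν₂0 : ν₂ (0, 0) = 0) (j t : ℝ) :
    SmoothGerm.IsDetermined 6 (SmoothGerm.germAtZero (hamiltonian a b ν₁ ν₂ j t)) := by
  set H := hamiltonian a b ν₁ ν₂ j t with hH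
  have hHs : ContDiff ℝ ∞ H := by
    unfold H hamiltonian
    fun_prop
  refine ⟨⟨H, Eventually.of_forall fun x => hHs.contDiffAt, rfl⟩, ?_⟩
  rintro _ ⟨f₀, hf₀, rfl⟩ hjet
  obtain ⟨f, hf, hff₀⟩ := exists_contDiff_eventuallyEq hf₀
  have hgerm : SmoothGerm.germAtZero f₀ = SmoothGerm.germAtZero f := Germ.coe_eq.2 hff₀.symm
  rw [hgerm] at hjet ⊢
  replace hjet : SmoothGerm.taylorPolynomial 6 f = SmoothGerm.taylorPolynomial 6 H := hjet
  have hfH : (fun x => f x - H x) =o[𝓝 0] fun x => ‖x‖ ^ 6 := by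
    refine ((SmoothGerm.sub_taylorPolynomial_isLittleO hf 6).sub
      (SmoothGerm.sub_taylorPolynomial_isLittleO hHs 6)).congr_left fun x => ?_
    rw [hjet]; ring
  obtain ⟨c, n, hc, hn, hn6, hlead⟩ := exists_leading_term (ν₁ (j, t) / 2) (ν₂ (j, t) / 4)
    (div_ne_zero hb (by norm_num : (6 : ℝ) ≠ 0))
  have hHh : ∀ x : ℝ × ℝ, H x = a / 2 * x.2 ^ 2 +
      (b / 6 * x.1 ^ 6 + ν₁ (j, t) / 2 * x.1 ^ 2 + ν₂ (j, t) / 4 * x.1 ^ 4) := fun x => by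
    simp only [hH, hamiltonian]; ring
  have ha2 : a / 2 ≠ 0 := by simpa using ha
  obtain ⟨Φ₁, h₁, h₁', hf₁⟩ := exists_normal_form ha2 hc hn hn6 hf
    (by simpa only [← hHh] using hfH) hlead
  -- `H` is normalized by the same lemma, with zero remainder and the same `c` and `n`.
  obtain ⟨Φ₂, h₂, h₂', hf₂⟩ := exists_normal_form ha2 hc hn hn6 hHs
    (by simpa only [← hHh, sub_self] using isLittleO_zero _ _) hlead
  exact SmoothGerm.equivalent_of_comp_eq (N := fun x => a / 2 * x.2 ^ 2 + c * x.1 ^ n)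
    h₁ h₁' h₂ h₂' hf₁ hf₂
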